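/- Let $P_1$ and $P_2$ be the Cantor distributions on $\mathbb R$, i.e. the unique Borel probability measures with \[P_1=\tfrac12 P_1\circ S_1^{-1}+\tfrac12 P_1\circ S_2^{-1},\qquad P_2=\tfrac12 P_2\circ T_1^{-1}+\tfrac12 P_2\circ T_2^{-1},\] where $S_1(x)=\frac13x$, $S_2(x)=\frac13x+\frac29$, $T_1(x)=\frac14x+\frac12$, $T_2(x)=\frac14x+\frac34$, and let $P=\frac12P_1+\frac12P_2$. For $n\ge 1$ let \[V_n(P)=\inf\Big\{\int\min_{a\in\alpha}|x-a|^2\,dP(x)\;:\;\emptyset\ne\alpha\subset\mathbb R,\ \operatorname{card}(\alpha)\le n\Big\}\] be the $n$th quantization error, and let $\beta=\frac{\log 2}{\log 3}$. Then the $\beta$-dimensional quantization coefficient of $P$ does not exist: $\liminf_{n\to\infty}n^{2/\beta}V_n(P)\neq\limsup_{n\to\infty}n^{2/\beta}V_n(P)$ (both taken in the extended reals). More precisely, the sequences $F(n)=2^{6n-4}+2^{5n-4}$ and $G(n)=2^{6n-4}+2^{6n-5}+2^{5n-3}$ are strictly increasing on the integers $n\ge1$, and \[\lim_{n\to\infty}F(n)^{2/\beta}V_{F(n)}(P)=\frac1{144},\qquad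 \lim_{n\to\infty}G(n)^{2/\beta}V_{G(n)}(P)=\frac5{16}\cdot3^{\frac{2\log3}{\log2}-6},\] and these two limits are different. -/

import Mathlib

open MeasureTheory Filter Topology
open scoped ENNReal

/-- The fair coin on `Bool`. -/
noncomputable def fairCoin : Measure Bool :=
  (2⁻¹ : ℝ≥0∞) • Measure.dirac false + (2⁻¹ : ℝ≥0∞) • Measure.dirac true

instance : IsProbabilityMeasure fairCoin := by
  constructor
  simp [fairCoin, ENNReal.inv_two_add_inv_two]

/-- The coding map of the pair of similarities `x ↦ r x + b₀`, `x ↦ r x + b₁`: it sends a sequence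
of symbols `ω₀ ω₁ ω₂ ⋯` to the limit of the compositions `S_{ω₀} ∘ S_{ω₁} ∘ ⋯ ∘ S_{ω_k}`. -/
noncomputable def cantorCode (r b₀ b₁ : ℝ) (ω : ℕ → Bool) : ℝ :=
  ∑' k, r ^ k * (if ω k then b₁ else b₀)

/-- The Cantor distribution of the pair of similarities `x ↦ r x + b₀`, `x ↦ r x + b₁` with equal
weights: the law of the coding map under a sequence of independent fair coins. By
`eq_cantorMeasure_iff` it is the unique Borel probability measure that is invariant under the
two maps with equal weights. -/
noncomputable def cantorMeasure (r b₀ b₁ : ℝ) : Measure ℝ :=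
  (Measure.infinitePi (fun _ : ℕ => fairCoin)).map (cantorCode r b₀ b₁)

/-- `μ` is a Borel probability measure with `μ = ½ μ ∘ S₁⁻¹ + ½ μ ∘ S₂⁻¹`. -/
def IsCantorDistribution (S₁ S₂ : ℝ → ℝ) (μ : Measure ℝ) : Prop :=
  IsProbabilityMeasure μ ∧
    μ = (2⁻¹ : ℝ≥0∞) • μ.map S₁ + (2⁻¹ : ℝ≥0∞) • μ.map S₂

theorem abs_cantor_term_le {r : ℝ} (hr0 : 0 ≤ r) (b₀ b₁ : ℝ) (k : ℕ) (ω : ℕ → Bool) :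
    ‖r ^ k * (if ω k then b₁ else b₀)‖ ≤ r ^ k * (|b₀| + |b₁|) := by
  rw [norm_mul, Real.norm_of_nonneg (pow_nonneg hr0 k)]
  refine mul_le_mul_of_nonneg_left ?_ (pow_nonneg hr0 k)
  have h0 := abs_nonneg b₀
  have h1 := abs_nonneg b₁
  split_ifs <;> rw [Real.norm_eq_abs] <;> linarith

theorem continuous_cantorCode {r : ℝ} (hr0 : 0 ≤ r) (hr1 : r < 1) (b₀ b₁ : ℝ) :
    Continuous (cantorCode r b₀ b₁) := by
  unfold cantorCode
  refine continuous_tsum (u := fun k => r ^ k * (|b₀| + |b₁|)) (fun k => ?_)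
    ((summable_geometric_of_lt_one hr0 hr1).mul_right _)
    (fun k ω => abs_cantor_term_le hr0 b₀ b₁ k ω)
  have h : Continuous (fun a : Bool => r ^ k * (if a then b₁ else b₀)) :=
    continuous_of_discreteTopology
  exact h.comp (continuous_apply k)

/-- Putting a symbol in front of a sequence. -/
def seqCons (a : Bool) (ω : ℕ → Bool) (n : ℕ) : Bool :=
  match n with
  | 0 => a
  | k + 1 => ω k

theorem measurable_seqCons (a : Bool) : Measurable (seqCons a) := by
  refine measurable_pi_lambda _ (fun n => ?_)
  cases n with
  | zero => exact measurable_const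
  | succ k => exact measurable_pi_apply k

theorem cantorCode_seqCons {r : ℝ} (hr0 : 0 ≤ r) (hr1 : r < 1) (b₀ b₁ : ℝ) (a : Bool)
    (ω : ℕ → Bool) :
    cantorCode r b₀ b₁ (seqCons a ω) =
      r * cantorCode r b₀ b₁ ω + (if a then b₁ else b₀) := by
  have hs : Summable (fun k => r ^ k * (if seqCons a ω k then b₁ else b₀)) :=
    Summable.of_norm_bounded ((summable_geometric_of_lt_one hr0 hr1).mul_right _)
      (fun k => abs_cantor_term_le hr0 b₀ b₁ k (seqCons a ω))
  unfold cantorCode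
  rw [hs.tsum_eq_zero_add, ← tsum_mul_left, add_comm]
  have hk : ∀ k, r ^ (k + 1) * (if seqCons a ω (k + 1) then b₁ else b₀) =
      r * (r ^ k * (if ω k then b₁ else b₀)) := fun k => by
    rw [pow_succ', mul_assoc]; rfl
  simp only [hk, pow_zero, one_mul]
  rfl

theorem infinitePi_fairCoin_eq :
    Measure.infinitePi (fun _ : ℕ => fairCoin) =
      (2⁻¹ : ℝ≥0∞) • (Measure.infinitePi (fun _ : ℕ => fairCoin)).map (seqCons false) +
      (2⁻¹ : ℝ≥0∞) • (Measure.infinitePi (fun _ : ℕ => fairCoin)).map (seqCons true) := by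
  symm
  refine Measure.eq_infinitePi (fun _ : ℕ => fairCoin) (fun s t _ => ?_)
  have ht : ∀ i, MeasurableSet (t i) := fun _ => MeasurableSet.of_discrete
  have hpi : MeasurableSet (Set.pi (s : Set ℕ) t) :=
    MeasurableSet.pi s.countable_toSet (fun i _ => ht i)
  -- enlarge `s` to an initial segment
  obtain ⟨N, hN⟩ : ∃ N, s ⊆ Finset.range (N + 1) := by
    obtain ⟨N, hN⟩ := s.exists_nat_subset_range
    exact ⟨N, hN.trans (Finset.range_mono (Nat.le_succ N))⟩
  let t' : ℕ → Set Bool := fun i => if i ∈ s then t i else Set.univ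
  have hset : Set.pi (s : Set ℕ) t = Set.pi (Finset.range (N + 1) : Set ℕ) t' := by
    ext ω
    simp only [Set.mem_pi, t']
    constructor
    · intro h i _
      split_ifs with hi
      · exact h i hi
      · trivial
    · intro h i hi
      have := h i (hN hi)
      rwa [if_pos (by exact_mod_cast hi)] at this
  have hprod : ∏ i ∈ s, fairCoin (t i) = ∏ i ∈ Finset.range (N + 1), fairCoin (t' i) := by
    rw [← Finset.prod_subset hN (f := fun i => fairCoin (t' i))]
    · exact Finset.prod_congr rfl (fun i hi => by simp [t', hi])
    · intro i _ hi
      simp only [t', hi, if_false]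
      exact measure_univ
  have hpre : ∀ a : Bool, seqCons a ⁻¹' (Set.pi (Finset.range (N + 1) : Set ℕ) t') =
      {_ω | a ∈ t' 0} ∩ Set.pi (Finset.range N : Set ℕ) (fun i => t' (i + 1)) := by
    intro a
    ext ω
    simp only [Set.mem_preimage, Set.mem_pi, Set.mem_inter_iff, Set.mem_ofPred_eq,
      Finset.coe_range, Set.mem_Iio]
    constructor
    · intro h
      exact ⟨h 0 (Nat.succ_pos N), fun i hi => h (i + 1) (Nat.succ_lt_succ hi)⟩
    · rintro ⟨h0, h1⟩ i hi
      cases i with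
      | zero => exact h0
      | succ k => exact h1 k (Nat.lt_of_succ_lt_succ hi)
  have hval : ∀ a : Bool,
      (Measure.infinitePi (fun _ : ℕ => fairCoin)).map (seqCons a) (Set.pi (s : Set ℕ) t) =
        (t' 0).indicator 1 a * ∏ i ∈ Finset.range N, fairCoin (t' (i + 1)) := by
    intro a
    rw [Measure.map_apply (measurable_seqCons a) hpi, hset, hpre]
    by_cases ha : a ∈ t' 0
    · simp only [ha, Set.ofPred_true, Set.univ_inter, Set.indicator_of_mem, Pi.one_apply, one_mul]
      exact Measure.infinitePi_pi _ (fun i _ => MeasurableSet.of_discrete)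
    · simp [ha]
  rw [hprod, Finset.prod_range_succ', Measure.add_apply, Measure.smul_apply, Measure.smul_apply,
    hval, hval]
  simp only [fairCoin, Measure.add_apply, Measure.smul_apply, smul_eq_mul,
    Measure.dirac_apply]
  ring

theorem isCantorDistribution_cantorMeasure {r : ℝ} (hr0 : 0 ≤ r) (hr1 : r < 1) (b₀ b₁ : ℝ) :
    IsCantorDistribution (fun x => r * x + b₀) (fun x => r * x + b₁) (cantorMeasure r b₀ b₁) := by
  have hm : Measurable (cantorCode r b₀ b₁) := (continuous_cantorCode hr0 hr1 b₀ b₁).measurable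
  refine ⟨Measure.isProbabilityMeasure_map hm.aemeasurable, ?_⟩
  have hS : ∀ b : ℝ, Measurable (fun x : ℝ => r * x + b) := fun b => by fun_prop
  unfold cantorMeasure
  conv_lhs => rw [infinitePi_fairCoin_eq]
  rw [Measure.map_add _ _ hm, Measure.map_smul, Measure.map_smul,
    Measure.map_map hm (measurable_seqCons _), Measure.map_map hm (measurable_seqCons _),
    Measure.map_map (hS b₀) hm, Measure.map_map (hS b₁) hm]
  have h0 : cantorCode r b₀ b₁ ∘ seqCons false = (fun x => r * x + b₀) ∘ cantorCode r b₀ b₁ := by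
    funext ω; simp [cantorCode_seqCons hr0 hr1]
  have h1 : cantorCode r b₀ b₁ ∘ seqCons true = (fun x => r * x + b₁) ∘ cantorCode r b₀ b₁ := by
    funext ω; simp [cantorCode_seqCons hr0 hr1]
  rw [h0, h1]

theorem charFun_of_isCantorDistribution {r b₀ b₁ : ℝ} {μ : Measure ℝ}
    (h : IsCantorDistribution (fun x => r * x + b₀) (fun x => r * x + b₁) μ) (t : ℝ) :
    charFun μ t =
      (2⁻¹ * Complex.exp (t * b₀ * Complex.I) + 2⁻¹ * Complex.exp (t * b₁ * Complex.I)) *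
        charFun μ (r * t) := by
  have hμ := h.1
  have hS : ∀ b : ℝ, Measurable (fun x : ℝ => r * x + b) := fun b => by fun_prop
  have hb : ∀ b : ℝ, charFun (μ.map (fun x => r * x + b)) t =
      Complex.exp (t * b * Complex.I) * charFun μ (r * t) := by
    intro b
    rw [charFun_apply_real, charFun_apply_real,
      integral_map (hS b).aemeasurable (by fun_prop), ← integral_const_mul]
    refine integral_congr_ae (Eventually.of_forall fun x => ?_)
    simp only [← Complex.exp_add]
    push_cast
    ring_nf
  have hp : ∀ b : ℝ, IsProbabilityMeasure (μ.map (fun x => r * x + b)) := fun b =>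
    Measure.isProbabilityMeasure_map (hS b).aemeasurable
  have hi : ∀ b : ℝ, Integrable (fun x : ℝ => Complex.exp (t * x * Complex.I))
      ((2⁻¹ : ℝ≥0∞) • μ.map (fun x => r * x + b)) := by
    intro b
    have := hp b
    refine Integrable.smul_measure ?_ (by simp)
    refine (integrable_const (1 : ℝ)).mono' (by fun_prop) (Eventually.of_forall fun x => ?_)
    rw [← Complex.ofReal_mul, Complex.norm_exp_ofReal_mul_I]
  conv_lhs => rw [h.2]
  rw [add_mul, mul_assoc (2⁻¹ : ℂ), mul_assoc (2⁻¹ : ℂ), ← hb, ← hb]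
  simp only [charFun_apply_real]
  rw [integral_add_measure (hi b₀) (hi b₁), integral_smul_measure, integral_smul_measure]
  simp

/-- The Cantor distribution is the only probability measure with the invariance property. -/
theorem eq_cantorMeasure_iff {r : ℝ} (hr0 : 0 ≤ r) (hr1 : r < 1) (b₀ b₁ : ℝ) (μ : Measure ℝ) :
    μ = cantorMeasure r b₀ b₁ ↔
      IsCantorDistribution (fun x => r * x + b₀) (fun x => r * x + b₁) μ := by
  have hc := isCantorDistribution_cantorMeasure hr0 hr1 b₀ b₁
  refine ⟨fun h => h ▸ hc, fun h => ?_⟩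
  have hp1 := h.1
  have hp2 := hc.1
  refine Measure.ext_of_charFun (funext fun t => ?_)
  set ν := cantorMeasure r b₀ b₁
  have step : ∀ u : ℝ, ‖charFun μ u - charFun ν u‖ ≤ ‖charFun μ (r * u) - charFun ν (r * u)‖ := by
    intro u
    rw [charFun_of_isCantorDistribution h u, charFun_of_isCantorDistribution hc u, ← mul_sub,
      norm_mul]
    refine mul_le_of_le_one_left (norm_nonneg _) ?_
    refine (norm_add_le _ _).trans ?_
    rw [norm_mul, norm_mul, ← Complex.ofReal_mul, ← Complex.ofReal_mul,
      Complex.norm_exp_ofReal_mul_I, Complex.norm_exp_ofReal_mul_I]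
    norm_num
  have iter : ∀ n : ℕ, ‖charFun μ t - charFun ν t‖ ≤
      ‖charFun μ (r ^ n * t) - charFun ν (r ^ n * t)‖ := by
    intro n
    induction n with
    | zero => simp
    | succ n ih =>
      refine ih.trans ((step _).trans (le_of_eq ?_))
      rw [pow_succ', mul_assoc]
  have hlim : Tendsto (fun n : ℕ => ‖charFun μ (r ^ n * t) - charFun ν (r ^ n * t)‖) atTop
      (𝓝 ‖charFun μ (0 * t) - charFun ν (0 * t)‖) := by
    have hcont : Continuous (fun u : ℝ => ‖charFun μ (u * t) - charFun ν (u * t)‖) :=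
      (((continuous_charFun (μ := μ)).comp (continuous_id.mul continuous_const)).sub
        ((continuous_charFun (μ := ν)).comp (continuous_id.mul continuous_const))).norm
    exact (hcont.tendsto 0).comp (tendsto_pow_atTop_nhds_zero_of_lt_one hr0 hr1)
  have := ge_of_tendsto' hlim iter
  simp only [zero_mul, charFun_zero] at this
  simp only [probReal_univ, sub_self, norm_zero] at this
  exact sub_eq_zero.mp (norm_le_zero_iff.mp this)

/-- The distortion error `∫ min_{a ∈ α} ‖x - a‖² dP(x)` of a finite nonempty set `α`. -/
noncomputable def distortion (P : Measure ℝ) (α : Finset ℝ) (hα : α.Nonempty) : ℝ :=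
  ∫ x, α.inf' hα (fun a => ‖x - a‖ ^ 2) ∂P

/-- The `n`th quantization error: the infimum of the distortion errors of the nonempty sets with
at most `n` points (`n ≥ 1`). -/
noncomputable def quantizationError (P : Measure ℝ) (n : ℕ) : ℝ :=
  sInf {d : ℝ | ∃ (α : Finset ℝ) (hα : α.Nonempty), α.card ≤ n ∧ d = distortion P α hα}

/-- The `s`-dimensional lower quantization coefficient `liminf n^{2/s} V_n(P)`. -/
noncomputable def lowerQuantizationCoefficient (s : ℝ) (P : Measure ℝ) : EReal :=
  liminf (fun n : ℕ => (((n : ℝ) ^ (2 / s) * quantizationError P n : ℝ) : EReal)) atTop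

/-- The `s`-dimensional upper quantization coefficient `limsup n^{2/s} V_n(P)`. -/
noncomputable def upperQuantizationCoefficient (s : ℝ) (P : Measure ℝ) : EReal :=
  limsup (fun n : ℕ => (((n : ℝ) ^ (2 / s) * quantizationError P n : ℝ) : EReal)) atTop

/-- The `s`-dimensional quantization coefficient exists: `n^{2/s} V_n(P)` has a limit (finite or
infinite), that is, the lower and the upper coefficient agree. -/
def QuantizationCoefficientExists (s : ℝ) (P : Measure ℝ) : Prop :=
  lowerQuantizationCoefficient s P = upperQuantizationCoefficient s P

/-- The Cantor distribution of `S₁ x = x / 3` and `S₂ x = x / 3 + 2 / 9`. -/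
noncomputable def cantorP₁ : Measure ℝ := cantorMeasure (1 / 3) 0 (2 / 9)

/-- The Cantor distribution of `T₁ x = x / 4 + 1 / 2` and `T₂ x = x / 4 + 3 / 4`. -/
noncomputable def cantorP₂ : Measure ℝ := cantorMeasure (1 / 4) (1 / 2) (3 / 4)

theorem eq_cantorP₁_iff (μ : Measure ℝ) :
    μ = cantorP₁ ↔
      IsCantorDistribution (fun x => 1 / 3 * x) (fun x => 1 / 3 * x + 2 / 9) μ := by
  have h := eq_cantorMeasure_iff (r := 1 / 3) (by norm_num) (by norm_num) 0 (2 / 9) μ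
  simp only [add_zero] at h
  exact h

theorem eq_cantorP₂_iff (μ : Measure ℝ) :
    μ = cantorP₂ ↔
      IsCantorDistribution (fun x => 1 / 4 * x + 1 / 2) (fun x => 1 / 4 * x + 3 / 4) μ :=
  eq_cantorMeasure_iff (by norm_num) (by norm_num) (1 / 2) (3 / 4) μ

/-- The mixed distribution `P = ½ P₁ + ½ P₂`. -/
noncomputable def mixedCantor : Measure ℝ :=
  (2⁻¹ : ℝ≥0∞) • cantorP₁ + (2⁻¹ : ℝ≥0∞) • cantorP₂

/-- `F(n) = 2^{6n-4} + 2^{5n-4}`, for `n ≥ 1`. -/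
def seqF (n : ℕ) : ℕ := 2 ^ (6 * n - 4) + 2 ^ (5 * n - 4)

/-- `G(n) = 2^{6n-4} + 2^{6n-5} + 2^{5n-3}`, for `n ≥ 1`. -/
def seqG (n : ℕ) : ℕ := 2 ^ (6 * n - 4) + 2 ^ (6 * n - 5) + 2 ^ (5 * n - 3)

/-! For `cantorP₁` the optimal error at `2 ^ l` points is `9⁻ˡ / 72`: one mean per cell of level
`l`. Interpolate these values linearly between consecutive powers of two. `supportLine l` is the
line through the values at `2 ^ l` and `2 ^ (l + 1)`, and `supportLine_le_distortion` says that
every finite set lies above every such line. The induction on `l` follows self-similarity: if each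
half of the Cantor set is served by points on its own side of the centre `1/6`, the set splits into
two rescaled sets, and `supportLine_succ_add` is the matching recursion. Otherwise some point serves
the opposite half (`Straddles`), and the distortion is already too large, by explicit estimates on a
few cells.

For the mixture, dropping the `cantorP₂` term gives `V_n(P) ≥ supportLine l n / 2`. Conversely,
spend `2 ^ (6n + 2)` points (for `F`), or one and a half times as many (for `G`), on `cantorP₁`, and
about `2 ^ (5n)` points on `cantorP₂`. The latter are negligible in number, and their error, of
order `16^(-5n)`, is negligible against `9^(-6n)` because `9^6 < 16^5`. Both bounds then agree in
the limit. With `ρ` the limit of `N / 2 ^ l` and `2 ^ s = 9`, the limit of `N ^ s * V_N` is `ρ ^ s *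
(17 - 8ρ) / 1296`, which takes different values at `ρ = 1` and `ρ = 3/2`. -/

section General

variable {r b₀ b₁ : ℝ}

/-! ### Integration against a Cantor measure. -/

theorem isProbabilityMeasure_cantorMeasure (hr0 : 0 ≤ r) (hr1 : r < 1) (b₀ b₁ : ℝ) :
    IsProbabilityMeasure (cantorMeasure r b₀ b₁) :=
  (isCantorDistribution_cantorMeasure hr0 hr1 b₀ b₁).1

theorem abs_cantorCode_le (hr0 : 0 ≤ r) (hr1 : r < 1) (b₀ b₁ : ℝ) (ω : ℕ → Bool) :
    ‖cantorCode r b₀ b₁ ω‖ ≤ (1 - r)⁻¹ * (|b₀| + |b₁|) :=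
  tsum_of_norm_bounded ((hasSum_geometric_of_lt_one hr0 hr1).mul_right _)
    (fun k => abs_cantor_term_le hr0 b₀ b₁ k ω)

theorem cantorCode_mem_Icc (hr0 : 0 ≤ r) (hr1 : r < 1) {b : ℝ} (hb : 0 ≤ b) (ω : ℕ → Bool) :
    cantorCode r 0 b ω ∈ Set.Icc 0 ((1 - r)⁻¹ * b) := by
  constructor
  · refine tsum_nonneg fun k => ?_
    split_ifs <;> positivity
  · have h := abs_cantorCode_le hr0 hr1 0 b ω
    rw [abs_zero, zero_add, abs_of_nonneg hb] at h
    exact (Real.le_norm_self _).trans h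

theorem ae_cantorMeasure (hr0 : 0 ≤ r) (hr1 : r < 1) {b₀ b₁ : ℝ} {s : Set ℝ}
    (hs : MeasurableSet s) (h : ∀ ω, cantorCode r b₀ b₁ ω ∈ s) :
    ∀ᵐ x ∂cantorMeasure r b₀ b₁, x ∈ s := by
  unfold cantorMeasure
  exact (ae_map_iff (p := (· ∈ s)) (continuous_cantorCode hr0 hr1 b₀ b₁).measurable.aemeasurable
    hs).mpr (Eventually.of_forall h)

theorem integrable_cantorMeasure (hr0 : 0 ≤ r) (hr1 : r < 1) (b₀ b₁ : ℝ) {f : ℝ → ℝ}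
    (hf : Continuous f) : Integrable f (cantorMeasure r b₀ b₁) := by
  have := isProbabilityMeasure_cantorMeasure hr0 hr1 b₀ b₁
  set M := (1 - r)⁻¹ * (|b₀| + |b₁|)
  obtain ⟨C, hC⟩ := (isCompact_Icc (a := -M) (b := M)).exists_bound_of_continuousOn
    hf.continuousOn
  refine (integrable_const C).mono' hf.aestronglyMeasurable ?_
  filter_upwards [ae_cantorMeasure hr0 hr1 (s := Set.Icc (-M) M) measurableSet_Icc
    (fun ω => abs_le.mp (abs_cantorCode_le hr0 hr1 b₀ b₁ ω))] with x hx using hC x hx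

theorem integral_cantorMeasure (hr0 : 0 ≤ r) (hr1 : r < 1) (b₀ b₁ : ℝ) {f : ℝ → ℝ}
    (hf : Continuous f) :
    ∫ x, f x ∂cantorMeasure r b₀ b₁ =
      (∫ x, f (r * x + b₀) ∂cantorMeasure r b₀ b₁ +
        ∫ x, f (r * x + b₁) ∂cantorMeasure r b₀ b₁) / 2 := by
  have hS : ∀ b : ℝ, Continuous (fun x : ℝ => r * x + b) := fun b => by fun_prop
  have hm : ∀ b : ℝ, ∫ x, f x ∂(cantorMeasure r b₀ b₁).map (fun x => r * x + b) =
      ∫ x, f (r * x + b) ∂cantorMeasure r b₀ b₁ := fun b =>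
    integral_map (hS b).measurable.aemeasurable hf.aestronglyMeasurable
  have hi : ∀ b : ℝ, Integrable f
      ((2⁻¹ : ℝ≥0∞) • (cantorMeasure r b₀ b₁).map (fun x => r * x + b)) := fun b => by
    refine Integrable.smul_measure ?_ (by simp)
    rw [integrable_map_measure hf.aestronglyMeasurable (hS b).measurable.aemeasurable]
    exact integrable_cantorMeasure hr0 hr1 b₀ b₁ (hf.comp (hS b))
  conv_lhs => rw [(isCantorDistribution_cantorMeasure hr0 hr1 b₀ b₁).2]
  rw [integral_add_measure (hi _) (hi _), integral_smul_measure, integral_smul_measure, hm, hm]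
  simp
  ring

/-- The squared distance to a finite set. -/
noncomputable def sqDist (α : Finset ℝ) (hα : α.Nonempty) (x : ℝ) : ℝ :=
  α.inf' hα (fun a => ‖x - a‖ ^ 2)

theorem continuous_sqDist (α : Finset ℝ) (hα : α.Nonempty) : Continuous (sqDist α hα) :=
  Continuous.finset_inf'_apply hα (fun a _ => by fun_prop)

theorem distortion_eq (P : Measure ℝ) (α : Finset ℝ) (hα : α.Nonempty) :
    distortion P α hα = ∫ x, sqDist α hα x ∂P := rfl

theorem le_sqDist_iff {α : Finset ℝ} {hα : α.Nonempty} {x c : ℝ} :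
    c ≤ sqDist α hα x ↔ ∀ a ∈ α, c ≤ (x - a) ^ 2 := by
  simp [sqDist, Finset.le_inf'_iff]

theorem sqDist_le {α : Finset ℝ} {hα : α.Nonempty} {a : ℝ} (ha : a ∈ α) (x : ℝ) :
    sqDist α hα x ≤ (x - a) ^ 2 := le_sqDist_iff.mp le_rfl a ha

theorem sqDist_nonneg (α : Finset ℝ) (hα : α.Nonempty) (x : ℝ) : 0 ≤ sqDist α hα x :=
  le_sqDist_iff.mpr fun _ _ => sq_nonneg _

theorem distortion_nonneg (P : Measure ℝ) (α : Finset ℝ) (hα : α.Nonempty) :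
    0 ≤ distortion P α hα :=
  integral_nonneg fun x => sqDist_nonneg α hα x

theorem sqDist_anti {α α' : Finset ℝ} {hα : α.Nonempty} {hα' : α'.Nonempty} (h : α ⊆ α') (x : ℝ) :
    sqDist α' hα' x ≤ sqDist α hα x :=
  le_sqDist_iff.mpr fun _ ha => sqDist_le (h ha) x

/-! ### Upper bounds by self-similarity. -/

/-- A measure has `n`-point quantizers with distortion error at most `v`. -/
def HasQuantizer (P : Measure ℝ) (n : ℕ) (v : ℝ) : Prop :=
  ∃ (α : Finset ℝ) (hα : α.Nonempty), α.card ≤ n ∧ distortion P α hα ≤ v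

/-- Each half gets a scaled copy of its own quantizer. Extra points only lower the distance, so no
separation of the two images is needed. -/
theorem HasQuantizer.join (hr0 : 0 ≤ r) (hr1 : r < 1) {n₀ n₁ : ℕ} {v₀ v₁ : ℝ}
    (h₀ : HasQuantizer (cantorMeasure r b₀ b₁) n₀ v₀)
    (h₁ : HasQuantizer (cantorMeasure r b₀ b₁) n₁ v₁) :
    HasQuantizer (cantorMeasure r b₀ b₁) (n₀ + n₁) (r ^ 2 * (v₀ + v₁) / 2) := by
  obtain ⟨α₀, hα₀, hc₀, hv₀⟩ := h₀
  obtain ⟨α₁, hα₁, hc₁, hv₁⟩ := h₁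
  classical
  have hne : (α₀.image (fun x => r * x + b₀) ∪ α₁.image (fun x => r * x + b₁)).Nonempty :=
    (hα₀.image _).inl
  refine ⟨_, hne, ?_, ?_⟩
  · exact (Finset.card_union_le _ _).trans (add_le_add (Finset.card_image_le.trans hc₀)
      (Finset.card_image_le.trans hc₁))
  have key : ∀ (β : Finset ℝ) (hβ : β.Nonempty) (b v : ℝ),
      β.image (fun x => r * x + b) ⊆
        α₀.image (fun x => r * x + b₀) ∪ α₁.image (fun x => r * x + b₁) →
      distortion (cantorMeasure r b₀ b₁) β hβ ≤ v →
      ∫ x, sqDist _ hne (r * x + b) ∂cantorMeasure r b₀ b₁ ≤ r ^ 2 * v := by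
    intro β hβ b v hsub hv
    refine le_trans ?_ (mul_le_mul_of_nonneg_left hv (sq_nonneg r))
    rw [distortion_eq, ← integral_const_mul]
    refine integral_mono (integrable_cantorMeasure hr0 hr1 _ _
      ((continuous_sqDist _ _).comp (by fun_prop)))
      ((integrable_cantorMeasure hr0 hr1 _ _ (continuous_sqDist _ _)).const_mul _) fun x => ?_
    obtain ⟨a, ha, hax⟩ := Finset.exists_mem_eq_inf' hβ (fun a => ‖x - a‖ ^ 2)
    have : sqDist β hβ x = (x - a) ^ 2 := by rw [sqDist, hax, Real.norm_eq_abs, sq_abs]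
    simp only [this]
    refine (sqDist_le (hsub (Finset.mem_image_of_mem _ ha)) _).trans (le_of_eq (by ring))
  rw [distortion_eq, integral_cantorMeasure hr0 hr1 b₀ b₁ (continuous_sqDist _ _)]
  have h0 := key α₀ hα₀ b₀ v₀ Finset.subset_union_left hv₀
  have h1 := key α₁ hα₁ b₁ v₁ Finset.subset_union_right hv₁
  linarith

theorem HasQuantizer.two_pow (hr0 : 0 ≤ r) (hr1 : r < 1) {v : ℝ}
    (h : HasQuantizer (cantorMeasure r b₀ b₁) 1 v) (l : ℕ) :
    HasQuantizer (cantorMeasure r b₀ b₁) (2 ^ l) ((r ^ 2) ^ l * v) := by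
  induction l with
  | zero => simpa using h
  | succ l ih =>
    convert HasQuantizer.join hr0 hr1 ih ih using 1 <;> ring

end General

/-! ### The mixture and its two components. -/

theorem bddBelow_distortions (P : Measure ℝ) (n : ℕ) :
    BddBelow {d : ℝ | ∃ (α : Finset ℝ) (hα : α.Nonempty), α.card ≤ n ∧ d = distortion P α hα} :=
  ⟨0, by rintro _ ⟨α, hα, _, rfl⟩; exact distortion_nonneg P α hα⟩

theorem isProbabilityMeasure_cantorP₁ : IsProbabilityMeasure cantorP₁ :=
  isProbabilityMeasure_cantorMeasure (by norm_num) (by norm_num) _ _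

theorem integrable_cantorP₁ {f : ℝ → ℝ} (hf : Continuous f) : Integrable f cantorP₁ :=
  integrable_cantorMeasure (by norm_num) (by norm_num) _ _ hf

theorem integrable_cantorP₂ {f : ℝ → ℝ} (hf : Continuous f) : Integrable f cantorP₂ :=
  integrable_cantorMeasure (by norm_num) (by norm_num) _ _ hf

theorem distortion_mixedCantor (α : Finset ℝ) (hα : α.Nonempty) :
    distortion mixedCantor α hα = (distortion cantorP₁ α hα + distortion cantorP₂ α hα) / 2 := by
  simp only [distortion_eq]
  rw [mixedCantor, integral_add_measure, integral_smul_measure, integral_smul_measure]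
  · simp
    ring
  · exact (integrable_cantorP₁ (continuous_sqDist _ _)).smul_measure (by simp)
  · exact (integrable_cantorP₂ (continuous_sqDist _ _)).smul_measure (by simp)

theorem quantizationError_mixedCantor_le {n₁ n₂ : ℕ} {v₁ v₂ : ℝ} (h₁ : HasQuantizer cantorP₁ n₁ v₁)
    (h₂ : HasQuantizer cantorP₂ n₂ v₂) :
    quantizationError mixedCantor (n₁ + n₂) ≤ (v₁ + v₂) / 2 := by
  obtain ⟨α₁, hα₁, hc₁, hv₁⟩ := h₁
  obtain ⟨α₂, hα₂, hc₂, hv₂⟩ := h₂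
  classical
  have hne : (α₁ ∪ α₂).Nonempty := hα₁.inl
  refine (csInf_le (bddBelow_distortions _ _) ⟨α₁ ∪ α₂, hne,
    (Finset.card_union_le _ _).trans (add_le_add hc₁ hc₂), rfl⟩).trans ?_
  rw [distortion_mixedCantor]
  have h1 : distortion cantorP₁ _ hne ≤ distortion cantorP₁ α₁ hα₁ :=
    integral_mono (integrable_cantorP₁ (continuous_sqDist _ _))
      (integrable_cantorP₁ (continuous_sqDist _ _)) (sqDist_anti Finset.subset_union_left)
  have h2 : distortion cantorP₂ _ hne ≤ distortion cantorP₂ α₂ hα₂ :=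
    integral_mono (integrable_cantorP₂ (continuous_sqDist _ _))
      (integrable_cantorP₂ (continuous_sqDist _ _)) (sqDist_anti Finset.subset_union_right)
  linarith

/-! ### Moments and symmetry of `cantorP₁`. -/

theorem integral_cantorP₁ {f : ℝ → ℝ} (hf : Continuous f) :
    ∫ x, f x ∂cantorP₁ =
      (∫ x, f (1 / 3 * x) ∂cantorP₁ + ∫ x, f (1 / 3 * x + 2 / 9) ∂cantorP₁) / 2 := by
  have h := integral_cantorMeasure (r := 1 / 3) (by norm_num) (by norm_num) 0 (2 / 9) hf
  simp only [add_zero] at h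
  exact h

theorem ae_cantorP₁ : ∀ᵐ x ∂cantorP₁, x ∈ Set.Icc (0 : ℝ) (1 / 3) := by
  refine ae_cantorMeasure (by norm_num) (by norm_num) measurableSet_Icc fun ω => ?_
  have := cantorCode_mem_Icc (r := 1 / 3) (by norm_num) (by norm_num) (b := 2 / 9) (by norm_num) ω
  norm_num at this ⊢
  exact this

theorem integral_cantorP₁_mono {f g : ℝ → ℝ} (hf : Continuous f) (hg : Continuous g)
    (h : ∀ x, 0 ≤ x → x ≤ 1 / 3 → f x ≤ g x) : ∫ x, f x ∂cantorP₁ ≤ ∫ x, g x ∂cantorP₁ :=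
  integral_mono_ae (integrable_cantorP₁ hf) (integrable_cantorP₁ hg)
    (ae_cantorP₁.mono fun x hx => h x hx.1 hx.2)

theorem integral_cantorP₁_const (c : ℝ) : ∫ _, c ∂cantorP₁ = c := by
  have := isProbabilityMeasure_cantorP₁
  simp

theorem integral_cantorP₁_affine (s t : ℝ) :
    ∫ x, (s * x + t) ∂cantorP₁ = s * ∫ x, x ∂cantorP₁ + t := by
  rw [integral_add (integrable_cantorP₁ (by fun_prop)) (integrable_cantorP₁ (by fun_prop)),
    integral_const_mul, integral_cantorP₁_const]

theorem mean_cantorP₁ : ∫ x, x ∂cantorP₁ = 1 / 6 := by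
  have h := integral_cantorP₁ continuous_id
  simp only [id] at h
  rw [integral_const_mul, integral_cantorP₁_affine] at h
  linarith

theorem integral_cantorP₁_quadratic (q s t : ℝ) :
    ∫ x, (q * x ^ 2 + s * x + t) ∂cantorP₁ = q * ∫ x, x ^ 2 ∂cantorP₁ + s / 6 + t := by
  rw [integral_add (integrable_cantorP₁ (by fun_prop)) (integrable_cantorP₁ (by fun_prop)),
    integral_add (integrable_cantorP₁ (by fun_prop)) (integrable_cantorP₁ (by fun_prop)),
    integral_const_mul, integral_const_mul, integral_cantorP₁_const, mean_cantorP₁]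
  ring

theorem second_moment_cantorP₁ : ∫ x, x ^ 2 ∂cantorP₁ = 1 / 24 := by
  have h := integral_cantorP₁ (f := fun x => x ^ 2) (by fun_prop)
  have h0 : ∀ x : ℝ, (1 / 3 * x) ^ 2 = 1 / 9 * x ^ 2 + 0 * x + 0 := fun x => by ring
  have h1 : ∀ x : ℝ, (1 / 3 * x + 2 / 9) ^ 2 = 1 / 9 * x ^ 2 + 4 / 27 * x + 4 / 81 :=
    fun x => by ring
  simp only [h0, h1, integral_cantorP₁_quadratic] at h
  linarith

/-- Squared bias plus variance: the mean is `1/6` and the variance is `1/24 - 1/36 = 1/72`. -/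
theorem integral_cantorP₁_sq (s t : ℝ) :
    ∫ x, (s * x + t) ^ 2 ∂cantorP₁ = (s / 6 + t) ^ 2 + s ^ 2 / 72 := by
  have h0 : ∀ x : ℝ, (s * x + t) ^ 2 = s ^ 2 * x ^ 2 + (2 * s * t) * x + t ^ 2 := fun x => by ring
  simp only [h0, integral_cantorP₁_quadratic, second_moment_cantorP₁]
  ring

theorem le_integral_cantorP₁_of_sq_le {f : ℝ → ℝ} (hf : Continuous f) (s t : ℝ)
    (h : ∀ x, 0 ≤ x → x ≤ 1 / 3 → (s * x + t) ^ 2 ≤ f x) :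
    (s / 6 + t) ^ 2 + s ^ 2 / 72 ≤ ∫ x, f x ∂cantorP₁ := by
  rw [← integral_cantorP₁_sq]
  exact integral_cantorP₁_mono (by fun_prop) hf h

theorem le_integral_cantorP₁_of_le {f : ℝ → ℝ} (hf : Continuous f) (c : ℝ)
    (h : ∀ x, 0 ≤ x → x ≤ 1 / 3 → c ≤ f x) : c ≤ ∫ x, f x ∂cantorP₁ := by
  rw [← integral_cantorP₁_const c]
  exact integral_cantorP₁_mono (by fun_prop) hf h

/-- By uniqueness: conjugation by the reflection exchanges the two similarities, so the reflected
measure satisfies the same invariance equation. -/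
theorem map_reflect_cantorP₁ : cantorP₁.map (fun x => 1 / 3 - x) = cantorP₁ := by
  have hp := isProbabilityMeasure_cantorP₁
  have hR : Measurable (fun x : ℝ => 1 / 3 - x) := by fun_prop
  rw [eq_cantorP₁_iff]
  refine ⟨Measure.isProbabilityMeasure_map hR.aemeasurable, ?_⟩
  conv_lhs => rw [((eq_cantorP₁_iff cantorP₁).mp rfl).2]
  rw [Measure.map_add _ _ hR, Measure.map_smul, Measure.map_smul,
    Measure.map_map hR (by fun_prop), Measure.map_map hR (by fun_prop),
    Measure.map_map (by fun_prop) hR, Measure.map_map (by fun_prop) hR, add_comm]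
  congr 3 <;> · funext x; simp only [Function.comp]; ring

theorem distortion_cantorP₁_reflect (α : Finset ℝ) (hα : α.Nonempty) :
    distortion cantorP₁ (α.image (fun x => 1 / 3 - x)) (hα.image _) = distortion cantorP₁ α hα := by
  simp only [distortion_eq]
  conv_lhs => rw [← map_reflect_cantorP₁]
  rw [integral_map (by fun_prop) (continuous_sqDist _ _).aestronglyMeasurable]
  congr 1
  funext x
  refine le_antisymm (le_sqDist_iff.mpr fun a ha => ?_) (le_sqDist_iff.mpr fun a ha => ?_)
  · exact (sqDist_le (Finset.mem_image_of_mem _ ha) _).trans (le_of_eq (by ring))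
  · obtain ⟨b, hb, rfl⟩ := Finset.mem_image.mp ha
    exact (sqDist_le hb _).trans (le_of_eq (by ring))

/-! ### Distortion on single cells. -/

/-- The mean squared distance to `α` of the image of `cantorP₁` under `x ↦ s x + t`. -/
noncomputable def cellDistortion (α : Finset ℝ) (hα : α.Nonempty) (s t : ℝ) : ℝ :=
  ∫ x, sqDist α hα (s * x + t) ∂cantorP₁

section

variable {α : Finset ℝ} {hα : α.Nonempty} {s t : ℝ}

theorem continuous_sqDist_affine (s t : ℝ) : Continuous fun x => sqDist α hα (s * x + t) :=
  (continuous_sqDist α hα).comp (by fun_prop)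

theorem distortion_eq_cellDistortion : distortion cantorP₁ α hα = cellDistortion α hα 1 0 := by
  simp [distortion_eq, cellDistortion]

theorem cellDistortion_nonneg (α : Finset ℝ) (hα : α.Nonempty) (s t : ℝ) :
    0 ≤ cellDistortion α hα s t :=
  integral_nonneg fun _ => sqDist_nonneg _ _ _

theorem cellDistortion_eq (α : Finset ℝ) (hα : α.Nonempty) (s t : ℝ) :
    cellDistortion α hα s t =
      (cellDistortion α hα (s / 3) t + cellDistortion α hα (s / 3) (2 / 9 * s + t)) / 2 := by
  unfold cellDistortion
  rw [integral_cantorP₁ (continuous_sqDist_affine s t)]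
  congr 3 <;> · funext x; congr 1; ring

/-- On a cell all of whose points have distance at least `|y - p|` from `α`. -/
theorem le_cellDistortion (p : ℝ)
    (h : ∀ x, 0 ≤ x → x ≤ 1 / 3 → ∀ a ∈ α, (s * x + t - p) ^ 2 ≤ (s * x + t - a) ^ 2) :
    (s / 6 + t - p) ^ 2 + s ^ 2 / 72 ≤ cellDistortion α hα s t := by
  rw [add_sub_assoc]
  refine le_integral_cantorP₁_of_sq_le (continuous_sqDist_affine s t) s (t - p) fun x h0 h1 => ?_
  rw [← add_sub_assoc]
  exact le_sqDist_iff.mpr (h x h0 h1)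

theorem le_cellDistortion_const (d : ℝ)
    (h : ∀ x, 0 ≤ x → x ≤ 1 / 3 → ∀ a ∈ α, d ^ 2 ≤ (s * x + t - a) ^ 2) :
    d ^ 2 ≤ cellDistortion α hα s t :=
  le_integral_cantorP₁_of_le (continuous_sqDist_affine s t) _ fun x h0 h1 =>
    le_sqDist_iff.mpr (h x h0 h1)

end

theorem le_distortion_of_card_eq_one {α : Finset ℝ} (hα : α.Nonempty) (h : α.card = 1) :
    1 / 72 ≤ distortion cantorP₁ α hα := by
  obtain ⟨a, rfl⟩ := Finset.card_eq_one.mp h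
  rw [distortion_eq_cellDistortion]
  refine le_trans ?_ (le_cellDistortion a ?_)
  · nlinarith [sq_nonneg (1 / 6 - a)]
  · intro x _ _ b hb
    rw [Finset.mem_singleton.mp hb]

/-! ### Straddling sets have large distortion. -/

/-- The point `a` of `α`, left of the centre, serves some points on the right. -/
def Straddles (α : Finset ℝ) (a : ℝ) : Prop :=
  a ∈ α ∧ a ≤ 1 / 6 ∧ ∀ b ∈ α, b ≤ a ∨ 4 / 9 - a ≤ b

section

variable {α : Finset ℝ} {hα : α.Nonempty} {a b c s t : ℝ}

theorem sq_le_sq_of_right {y p a : ℝ} (h0 : y ≤ p) (h1 : p ≤ a) : (y - p) ^ 2 ≤ (y - a) ^ 2 := by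
  nlinarith

theorem sq_le_sq_of_left {y p a : ℝ} (h0 : p ≤ y) (h1 : a ≤ p) : (y - p) ^ 2 ≤ (y - a) ^ 2 := by
  nlinarith

/-- The second hypothesis places `y` at or beyond the midpoint of `a` and `p`. These comparisons let
one virtual point `p` replace all of `α` on a cell. -/
theorem sq_le_sq_of_far_left {y p a : ℝ} (h0 : y ≤ p) (h1 : a + p ≤ 2 * y) :
    (y - p) ^ 2 ≤ (y - a) ^ 2 := by
  nlinarith

theorem sq_le_sq_of_far_right {y p a : ℝ} (h0 : p ≤ y) (h1 : 2 * y ≤ a + p) :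
    (y - p) ^ 2 ≤ (y - a) ^ 2 := by
  nlinarith

theorem sq_le_sq_of_dist_right {y d a : ℝ} (h0 : 0 ≤ d) (h1 : y + d ≤ a) :
    d ^ 2 ≤ (y - a) ^ 2 := by
  nlinarith

theorem sq_le_sq_of_dist_left {y d a : ℝ} (h0 : 0 ≤ d) (h1 : a + d ≤ y) :
    d ^ 2 ≤ (y - a) ^ 2 := by
  nlinarith

/-- The parameters `s`, `t` describe the cell inside `[t, t + s / 3]`; here the halves lie in `[0,
1/9]` and `[2/9, 1/3]`. -/
theorem distortion_eq_halves (α : Finset ℝ) (hα : α.Nonempty) :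
    distortion cantorP₁ α hα =
      (cellDistortion α hα (1 / 3) 0 + cellDistortion α hα (1 / 3) (2 / 9)) / 2 := by
  rw [distortion_eq_cellDistortion, cellDistortion_eq]
  norm_num

theorem cellDistortion_left (α : Finset ℝ) (hα : α.Nonempty) :
    cellDistortion α hα (1 / 3) 0 =
      (cellDistortion α hα (1 / 9) 0 + cellDistortion α hα (1 / 9) (2 / 27)) / 2 := by
  rw [cellDistortion_eq]
  norm_num

theorem cellDistortion_right (α : Finset ℝ) (hα : α.Nonempty) :
    cellDistortion α hα (1 / 3) (2 / 9) =
      (cellDistortion α hα (1 / 9) (2 / 9) + cellDistortion α hα (1 / 9) (8 / 27)) / 2 := by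
  rw [cellDistortion_eq]
  norm_num

theorem cellDistortion_left_right (α : Finset ℝ) (hα : α.Nonempty) :
    cellDistortion α hα (1 / 9) (2 / 27) =
      (cellDistortion α hα (1 / 27) (2 / 27) + cellDistortion α hα (1 / 27) (8 / 81)) / 2 := by
  rw [cellDistortion_eq]
  norm_num

theorem cellDistortion_right_left (α : Finset ℝ) (hα : α.Nonempty) :
    cellDistortion α hα (1 / 9) (2 / 9) =
      (cellDistortion α hα (1 / 27) (2 / 9) + cellDistortion α hα (1 / 27) (20 / 81)) / 2 := by
  rw [cellDistortion_eq]
  norm_num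

/-- The reflection of `a` in `2/9` is `4/9 - a ≥ 5/18`. Hence on the cell `[2/9, 7/27]` no point of
`α` does better than the virtual point `5/18`, the reflection of `1/6`. -/
theorem Straddles.le_distortion (h : Straddles α a) : 1 / 2592 ≤ distortion cantorP₁ α hα := by
  obtain ⟨-, ha, hb⟩ := h
  have h0 := cellDistortion_nonneg α hα (1 / 3) 0
  have h1 := cellDistortion_nonneg α hα (1 / 9) (8 / 27)
  have h2 : 1 / 648 ≤ cellDistortion α hα (1 / 9) (2 / 9) := by
    refine le_trans (by norm_num) (le_cellDistortion (5 / 18) fun x hx0 hx1 b hbα => ?_)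
    rcases hb b hbα with h | h
    · exact sq_le_sq_of_far_left (by linarith) (by linarith)
    · exact sq_le_sq_of_right (by linarith) (by linarith)
  rw [distortion_eq_halves, cellDistortion_right]
  linarith

theorem le_distortion_of_forall_le (h : ∀ b ∈ α, b ≤ 1 / 6) :
    1 / 144 ≤ distortion cantorP₁ α hα := by
  have h0 := cellDistortion_nonneg α hα (1 / 3) 0
  have h2 : 1 / 72 ≤ cellDistortion α hα (1 / 3) (2 / 9) :=
    le_trans (by norm_num) (le_cellDistortion (1 / 6) fun x hx0 hx1 b hb =>
      sq_le_sq_of_left (by linarith) (h b hb))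
  rw [distortion_eq_halves]
  linarith

theorem le_distortion_of_forall_ge (h : ∀ b ∈ α, 1 / 9 ≤ b) :
    1 / 432 ≤ distortion cantorP₁ α hα := by
  have h0 := cellDistortion_nonneg α hα (1 / 3) (2 / 9)
  have h2 : 1 / 216 ≤ cellDistortion α hα (1 / 3) 0 :=
    le_trans (by norm_num) (le_cellDistortion (1 / 9) fun x hx0 hx1 b hb =>
      sq_le_sq_of_right (by linarith) (h b hb))
  rw [distortion_eq_halves]
  linarith

theorem Straddles.le_distortion_of_le (h : Straddles α a) (ha9 : a ≤ 1 / 9) :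
    17 / 7776 ≤ distortion cantorP₁ α hα := by
  obtain ⟨-, ha, hb⟩ := h
  have h0 := cellDistortion_nonneg α hα (1 / 3) 0
  have h1 := cellDistortion_nonneg α hα (1 / 9) (8 / 27)
  have h2 : 17 / 1944 ≤ cellDistortion α hα (1 / 9) (2 / 9) := by
    -- With `a ≤ 1/9` the reflected bound becomes `4/9 - 1/9 = 1/3`.
    refine le_trans (by norm_num) (le_cellDistortion (1 / 3) fun x hx0 hx1 b hbα => ?_)
    rcases hb b hbα with h | h
    · exact sq_le_sq_of_far_left (by linarith) (by linarith)
    · exact sq_le_sq_of_right (by linarith) (by linarith)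
  rw [distortion_eq_halves, cellDistortion_right]
  linarith

/-- The left half is served by a point `c` and by points outside it. -/
theorem le_cellDistortion_left (h : ∀ b ∈ α, b = c ∨ 1 / 9 ≤ b) :
    1 / 2916 ≤ cellDistortion α hα (1 / 3) 0 := by
  have hge : ∀ p, p ≤ 1 / 9 → 1 / 27 ≤ p → p ≤ c →
      (1 / 54 - p) ^ 2 + 1 / 5832 ≤ cellDistortion α hα (1 / 9) 0 := by
    intro p hp hp' hpc
    refine le_trans (le_of_eq (by ring)) (le_cellDistortion p fun x hx0 hx1 b hb => ?_)
    rcases h b hb with rfl | h <;> exact sq_le_sq_of_right (by linarith) (by linarith)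
  rw [cellDistortion_left]
  -- The first case is the sharp one: equality holds for `α = {1/54, 1/9}`. If `c` lies beyond the
  -- cell `[0, 1/27]`, that cell costs enough, with help from `[2/27, 7/81]` while `c ≤ 7/162`.
  rcases le_total c (1 / 27) with hc1 | hc1
  · have hL1 : 1 / 5832 ≤ cellDistortion α hα (1 / 9) 0 := by
      rcases le_total c (-1 / 27) with hc2 | hc2
      · refine le_trans (by norm_num) (le_cellDistortion_const (1 / 27) fun x hx0 hx1 b hb => ?_)
        rcases h b hb with rfl | h
        · exact sq_le_sq_of_dist_left (by norm_num) (by linarith)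
        · exact sq_le_sq_of_dist_right (by norm_num) (by linarith)
      · refine le_trans ?_ (le_cellDistortion c fun x hx0 hx1 b hb => ?_)
        · nlinarith [sq_nonneg (1 / 54 - c)]
        · rcases h b hb with rfl | h
          · exact le_rfl
          · rcases le_total c (1 / 9 * x + 0) with h2 | h2
            · exact sq_le_sq_of_far_right h2 (by linarith)
            · exact sq_le_sq_of_right h2 (by linarith)
    have hL2 : 1 / 1944 ≤ cellDistortion α hα (1 / 9) (2 / 27) := by
      refine le_trans (by norm_num) (le_cellDistortion (1 / 9) fun x hx0 hx1 b hb => ?_)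
      rcases h b hb with rfl | h
      · exact sq_le_sq_of_far_left (by linarith) (by linarith)
      · exact sq_le_sq_of_right (by linarith) (by linarith)
    linarith
  rcases le_total c (7 / 162) with hc2 | hc2
  · have hL1 := hge (1 / 27) (by norm_num) le_rfl hc1
    have hL2 : (2 / 81) ^ 2 ≤ cellDistortion α hα (1 / 27) (2 / 27) := by
      refine le_cellDistortion_const _ fun x hx0 hx1 b hb => ?_
      rcases h b hb with rfl | h
      · exact sq_le_sq_of_dist_left (by norm_num) (by linarith)
      · exact sq_le_sq_of_dist_right (by norm_num) (by linarith)
    have hL3 := cellDistortion_nonneg α hα (1 / 27) (8 / 81)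
    rw [cellDistortion_left_right]
    linarith
  · have hL1 := hge (7 / 162) (by norm_num) (by norm_num) hc2
    have hL2 := cellDistortion_nonneg α hα (1 / 9) (2 / 27)
    linarith

/-- The right half is served by a point `b` inside it and by points left of the centre. -/
theorem le_cellDistortion_right (hb : 5 / 18 ≤ b) (h : ∀ a ∈ α, a = b ∨ a ≤ 1 / 6) :
    1 / 729 ≤ cellDistortion α hα (1 / 3) (2 / 9) := by
  rw [cellDistortion_right, cellDistortion_right_left]
  have hR12 : b ≤ 25 / 81 →
      (41 / 162 - b) ^ 2 + 1 / 52488 ≤ cellDistortion α hα (1 / 27) (20 / 81) := by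
    intro hb2
    refine le_trans (le_of_eq (by ring)) (le_cellDistortion b fun x hx0 hx1 a ha => ?_)
    rcases h a ha with rfl | h
    · exact le_rfl
    · exact sq_le_sq_of_far_left (by linarith) (by linarith)
  have hR2 : b ≤ 25 / 81 →
      (17 / 54 - b) ^ 2 + 1 / 5832 ≤ cellDistortion α hα (1 / 9) (8 / 27) := by
    intro hb2
    refine le_trans (le_of_eq (by ring)) (le_cellDistortion b fun x hx0 hx1 a ha => ?_)
    rcases h a ha with rfl | h
    · exact le_rfl
    · rcases le_total (1 / 9 * x + 8 / 27) b with h2 | h2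
      · exact sq_le_sq_of_far_left h2 (by linarith)
      · exact sq_le_sq_of_left h2 (by linarith)
  -- For small `b` the subcell `[2/9, 19/81]` is compared with the virtual point `5/18`. Past
  -- `31/108` its distance to `α` is at least `31/108 - 19/81 = 17/324`. Past `25/81` distances
  -- alone suffice.
  rcases le_total b (31 / 108) with hb1 | hb1
  · have h11 : (8 / 162) ^ 2 + 1 / 52488 ≤ cellDistortion α hα (1 / 27) (2 / 9) := by
      refine le_trans (by norm_num) (le_cellDistortion (5 / 18) fun x hx0 hx1 a ha => ?_)
      rcases h a ha with rfl | h
      · exact sq_le_sq_of_right (by linarith) (by linarith)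
      · exact sq_le_sq_of_far_left (by linarith) (by linarith)
    have h12 := hR12 (by linarith)
    have h2 := hR2 (by linarith)
    nlinarith
  rcases le_total b (25 / 81) with hb2 | hb2
  · have h11 : (17 / 324) ^ 2 ≤ cellDistortion α hα (1 / 27) (2 / 9) := by
      refine le_cellDistortion_const _ fun x hx0 hx1 a ha => ?_
      rcases h a ha with rfl | h
      · exact sq_le_sq_of_dist_right (by norm_num) (by linarith)
      · exact sq_le_sq_of_dist_left (by norm_num) (by linarith)
    have h12 := hR12 hb2
    have h2 := hR2 hb2
    -- The minimizer in `b`: the mean of the centres `41/162` and `17/54` with weights `1 : 2`, the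
    -- masses of their cells.
    nlinarith [sq_nonneg (b - 143 / 486)]
  · have h11 : (9 / 162) ^ 2 ≤ cellDistortion α hα (1 / 27) (2 / 9) := by
      refine le_cellDistortion_const _ fun x hx0 hx1 a ha => ?_
      rcases h a ha with rfl | h
      · exact sq_le_sq_of_dist_right (by norm_num) (by linarith)
      · exact sq_le_sq_of_dist_left (by norm_num) (by linarith)
    have h12 : (8 / 162) ^ 2 ≤ cellDistortion α hα (1 / 27) (20 / 81) := by
      refine le_cellDistortion_const _ fun x hx0 hx1 a ha => ?_
      rcases h a ha with rfl | h
      · exact sq_le_sq_of_dist_right (by norm_num) (by linarith)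
      · exact sq_le_sq_of_dist_left (by norm_num) (by linarith)
    have h2 := cellDistortion_nonneg α hα (1 / 9) (8 / 27)
    linarith

/-- The lower bound for straddled sets that is sharp for two and three points. -/
theorem Straddles.le_distortion_card (h : Straddles α a) :
    (17 - 4 * α.card) / 5832 ≤ distortion cantorP₁ α hα := by
  have hs := h.le_distortion (hα := hα)
  -- From four points on, the left side is at most `1/5832 < 1/2592`.
  rcases le_or_gt 4 α.card with hn | hn
  · have : (4 : ℝ) ≤ α.card := by exact_mod_cast hn
    linarith
  by_cases h1 : ∀ b ∈ α, b ≤ 1 / 6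
  · have h2 := le_distortion_of_forall_le (hα := hα) h1
    rcases le_or_gt α.card 1 with hc | hc
    · have := le_distortion_of_card_eq_one hα (le_antisymm hc hα.card_pos)
      have hc1 : (1 : ℝ) ≤ α.card := by exact_mod_cast hα.card_pos
      linarith
    · have : (2 : ℝ) ≤ α.card := by exact_mod_cast hc
      linarith
  push Not at h1
  obtain ⟨b, hb, hb6⟩ := h1
  have hab : a ≠ b := (h.2.1.trans_lt hb6).ne
  have hc2 : ({a, b} : Finset ℝ).card ≤ α.card :=
    Finset.card_le_card (by simp [Finset.insert_subset_iff, h.1, hb])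
  rw [Finset.card_pair hab] at hc2
  have hc2' : (2 : ℝ) ≤ α.card := by exact_mod_cast hc2
  rcases le_or_gt a (1 / 9) with ha9 | ha9
  · have := h.le_distortion_of_le (hα := hα) ha9
    linarith
  by_cases h1 : ∀ b ∈ α, 1 / 9 ≤ b
  · have := le_distortion_of_forall_ge (hα := hα) h1
    linarith
  push Not at h1
  obtain ⟨c, hc, hc9⟩ := h1
  have hsub : ({a, b, c} : Finset ℝ) ⊆ α := by simp [Finset.insert_subset_iff, h.1, hb, hc]
  have hcard : ({a, b, c} : Finset ℝ).card = 3 :=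
    Finset.card_eq_three.mpr ⟨a, b, c, hab, (hc9.trans ha9).ne', by linarith, rfl⟩
  -- At most three points remain possible, and `c < 1/9 < a ≤ 1/6 < b` are three. So the left half
  -- has only `c` inside it, and the right half only `b`.
  have hα3 : {a, b, c} = α := Finset.eq_of_subset_of_card_le hsub (by omega)
  have hc3 : (α.card : ℝ) = 3 := by rw [← hα3, hcard]; norm_num
  have hmem : ∀ x ∈ α, x = a ∨ x = b ∨ x = c := fun x hx => by simpa [← hα3] using hx
  have hL := le_cellDistortion_left (hα := hα) (c := c) fun x hx => by
    rcases hmem x hx with rfl | rfl | rfl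
    · exact Or.inr ha9.le
    · exact Or.inr (by linarith)
    · exact Or.inl rfl
  have hb18 : 5 / 18 ≤ b := by
    rcases h.2.2 b hb with h' | h' <;> linarith [h.2.1]
  have hR := le_cellDistortion_right (hα := hα) hb18 fun x hx => by
    rcases hmem x hx with rfl | rfl | rfl
    · exact Or.inr h.2.1
    · exact Or.inl rfl
    · exact Or.inr (by linarith)
  rw [distortion_eq_halves, hc3]
  -- The halves give `(1/2916 + 1/729) / 2 = 5/5832`, exactly the required value at three points.
  linarith

end

/-! ### The supporting lines and the induction. -/

/-- An affine function of the number `n` of points; as `l` varies these support the convex function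
that interpolates the quantization errors of `cantorP₁` at the powers of two. -/
noncomputable def supportLine (l n : ℕ) : ℝ :=
  (17 * (1 / 9) ^ l - 8 * n * (1 / 18) ^ l) / 648

theorem supportLine_anti (l : ℕ) {m n : ℕ} (h : m ≤ n) : supportLine l n ≤ supportLine l m := by
  have h' : (m : ℝ) ≤ n := by exact_mod_cast h
  unfold supportLine
  gcongr

/-- The factor `1/18` is the squared contraction ratio `1/9` times the weight `1/2`. -/
theorem supportLine_succ_add (l m n : ℕ) :
    supportLine (l + 1) (m + n) = (supportLine l m + supportLine l n) / 18 := by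
  unfold supportLine
  push_cast
  ring

theorem Straddles.supportLine_le {α : Finset ℝ} {hα : α.Nonempty} {a : ℝ} (h : Straddles α a)
    (l : ℕ) : supportLine (l + 1) α.card ≤ distortion cantorP₁ α hα := by
  unfold supportLine
  cases l with
  | zero =>
    have := h.le_distortion_card (hα := hα)
    norm_num at this ⊢
    linarith
  | succ l =>
    -- From level two on, the constant term is at most `17 / (81 * 648) < 1/2592`, whatever the
    -- cardinality.
    have := h.le_distortion (hα := hα)
    have h1 : (1 / 9 : ℝ) ^ l ≤ 1 := pow_le_one₀ (by norm_num) (by norm_num)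
    have h2 : (0 : ℝ) ≤ 8 * α.card * (1 / 18) ^ (l + 1 + 1) := by positivity
    have h3 : (1 / 9 : ℝ) ^ (l + 1 + 1) = (1 / 9) ^ l / 81 := by ring
    rw [h3]
    linarith

/-- If every point on the right is served best by points right of the centre, or else some point
straddles. -/
theorem exists_straddles_or (α : Finset ℝ) :
    (∃ a, Straddles α a) ∨
      ∀ x, 2 / 9 ≤ x → ∀ a ∈ α, a ≤ 1 / 6 → ∃ b ∈ α, 1 / 6 < b ∧ (x - b) ^ 2 ≤ (x - a) ^ 2 := by
  rw [or_iff_not_imp_right]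
  intro h
  push Not at h
  obtain ⟨x, hx, a, ha, ha6, hb⟩ := h
  have hne : (α.filter (· ≤ 1 / 6)).Nonempty := ⟨a, Finset.mem_filter.mpr ⟨ha, ha6⟩⟩
  -- The straddling point is the largest one left of the centre: if some left point `a` beats every
  -- right point at `x ≥ 2/9`, then all right points exceed `4/9 - a`.
  have hmax := Finset.max'_mem _ hne
  set m := (α.filter (· ≤ 1 / 6)).max' hne
  have ham : a ≤ m := Finset.le_max' _ _ (Finset.mem_filter.mpr ⟨ha, ha6⟩)
  rw [Finset.mem_filter] at hmax
  refine ⟨m, hmax.1, hmax.2, fun b hbα => ?_⟩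
  rcases le_or_gt b (1 / 6) with hb6 | hb6
  · exact Or.inl (Finset.le_max' _ _ (Finset.mem_filter.mpr ⟨hbα, hb6⟩))
  · right
    have := hb b hbα hb6
    by_contra! hlt
    nlinarith

theorem le_distortion_cantorP₁_of_split {α : Finset ℝ} {hα : α.Nonempty} {l : ℕ}
    (ih : ∀ (β : Finset ℝ) (hβ : β.Nonempty), β.card < α.card →
      supportLine l β.card ≤ distortion cantorP₁ β hβ)
    (hR : ∀ x, 2 / 9 ≤ x → ∀ a ∈ α, a ≤ 1 / 6 → ∃ b ∈ α, 1 / 6 < b ∧ (x - b) ^ 2 ≤ (x - a) ^ 2)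
    (hL : ∀ x, x ≤ 1 / 9 → ∀ a ∈ α, 1 / 6 < a → ∃ b ∈ α, b ≤ 1 / 6 ∧ (x - b) ^ 2 ≤ (x - a) ^ 2) :
    supportLine (l + 1) α.card ≤ distortion cantorP₁ α hα := by
  have key : ∀ (β : Finset ℝ) (hβ : β.Nonempty) (t : ℝ), β.card < α.card →
      (∀ x, 0 ≤ x → x ≤ 1 / 3 → ∀ a ∈ α, ∃ b ∈ β, (1 / 3 * x + t - b) ^ 2 ≤
        (1 / 3 * x + t - a) ^ 2) →
      supportLine l β.card / 9 ≤ cellDistortion α hα (1 / 3) t := by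
    intro β hβ t hβα h
    -- The inverse similarity carries the points serving one half back to the full Cantor set.
    have hβ' := hβ.image (fun b => 3 * (b - t))
    have h1 := (supportLine_anti l (Finset.card_image_le)).trans (ih _ hβ' (Finset.card_image_le.trans_lt hβα))
    refine (div_le_div_of_nonneg_right h1 (by norm_num)).trans ?_
    rw [distortion_eq, ← integral_div]
    refine integral_cantorP₁_mono ((continuous_sqDist _ _).div_const _)
      (continuous_sqDist_affine _ _) fun x h0 h1 => le_sqDist_iff.mpr fun a ha => ?_
    obtain ⟨b, hb, hba⟩ := h x h0 h1 a ha
    have := sqDist_le (hα := hβ') (Finset.mem_image_of_mem _ hb) x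
    refine le_trans ?_ hba
    rw [div_le_iff₀ (by norm_num)]
    exact this.trans (le_of_eq (by ring))
  have hcard := Finset.card_filter_add_card_filter_not (s := α) (fun a => a ≤ 1 / 6)
  simp only [not_le] at hcard
  have hmem : ∀ x a, a ∈ α → x ≤ 1 / 9 →
      ∃ b ∈ α.filter (· ≤ 1 / 6), (x - b) ^ 2 ≤ (x - a) ^ 2 := by
    intro x a ha hx
    rcases le_or_gt a (1 / 6) with h6 | h6
    · exact ⟨a, Finset.mem_filter.mpr ⟨ha, h6⟩, le_rfl⟩
    · obtain ⟨b, hb, hb6, hba⟩ := hL x hx a ha h6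
      exact ⟨b, Finset.mem_filter.mpr ⟨hb, hb6⟩, hba⟩
  have hmem' : ∀ x a, a ∈ α → 2 / 9 ≤ x →
      ∃ b ∈ α.filter (1 / 6 < ·), (x - b) ^ 2 ≤ (x - a) ^ 2 := by
    intro x a ha hx
    rcases le_or_gt a (1 / 6) with h6 | h6
    · obtain ⟨b, hb, hb6, hba⟩ := hR x hx a ha h6
      exact ⟨b, Finset.mem_filter.mpr ⟨hb, hb6⟩, hba⟩
    · exact ⟨a, Finset.mem_filter.mpr ⟨ha, h6⟩, le_rfl⟩
  have hne : (α.filter (· ≤ 1 / 6)).Nonempty := by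
    obtain ⟨a, ha⟩ := hα
    obtain ⟨b, hb, -⟩ := hmem 0 a ha (by norm_num)
    exact ⟨b, hb⟩
  have hne' : (α.filter (1 / 6 < ·)).Nonempty := by
    obtain ⟨a, ha⟩ := hα
    obtain ⟨b, hb, -⟩ := hmem' (2 / 9) a ha le_rfl
    exact ⟨b, hb⟩
  have hpos := hne.card_pos
  have hpos' := hne'.card_pos
  have h0 := key _ hne 0 (by omega) fun x h0 h1 a ha => hmem _ a ha (by linarith)
  have h1 := key _ hne' (2 / 9) (by omega) fun x h0 h1 a ha => hmem' _ a ha (by linarith)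
  rw [← hcard, supportLine_succ_add, distortion_eq_halves]
  linarith

/-- The hypothesis is needed only for smaller cardinalities, since a split set has points on both
sides. This also allows its use at level zero, where two-point sets rest on one-point sets. -/
theorem supportLine_succ_le_distortion {α : Finset ℝ} (hα : α.Nonempty) {l : ℕ}
    (ih : ∀ (β : Finset ℝ) (hβ : β.Nonempty), β.card < α.card →
      supportLine l β.card ≤ distortion cantorP₁ β hβ) :
    supportLine (l + 1) α.card ≤ distortion cantorP₁ α hα := by
  rcases exists_straddles_or α with ⟨a, ha⟩ | hR
  · exact ha.supportLine_le l
  rcases exists_straddles_or (α.image (fun x => 1 / 3 - x)) with ⟨a, ha⟩ | hL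
  · rw [← distortion_cantorP₁_reflect]
    exact (supportLine_anti _ Finset.card_image_le).trans (ha.supportLine_le l)
  refine le_distortion_cantorP₁_of_split ih hR fun x hx a ha ha6 => ?_
  obtain ⟨b, hb, hb6, hba⟩ := hL (1 / 3 - x) (by linarith) (1 / 3 - a)
    (Finset.mem_image_of_mem _ ha) (by linarith)
  obtain ⟨c, hc, rfl⟩ := Finset.mem_image.mp hb
  exact ⟨c, hc, by linarith, by nlinarith⟩

theorem supportLine_le_distortion (l : ℕ) (α : Finset ℝ) (hα : α.Nonempty) :
    supportLine l α.card ≤ distortion cantorP₁ α hα := by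
  induction l generalizing α with
  | zero =>
    have h1 : ∀ (β : Finset ℝ) (hβ : β.Nonempty), β.card < 2 →
        supportLine 0 β.card ≤ distortion cantorP₁ β hβ := by
      intro β hβ h
      have h1 : β.card = 1 := le_antisymm (Nat.lt_succ_iff.mp h) hβ.card_pos
      refine le_trans ?_ (le_distortion_of_card_eq_one hβ h1)
      norm_num [supportLine, h1]
    rcases lt_trichotomy α.card 2 with h | h | h
    · exact h1 α hα h
    -- The lines of levels `0` and `1` meet at two points, both having the value `1/648`.
    · refine le_trans ?_ (supportLine_succ_le_distortion hα (l := 0) fun β hβ hc => ?_)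
      · norm_num [supportLine, h]
      · exact h1 β hβ (h ▸ hc)
    -- From three points on, the line of level zero is negative.
    · refine le_trans ?_ (distortion_nonneg _ _ _)
      have h3 : (3 : ℝ) ≤ α.card := by exact_mod_cast h
      simp only [supportLine, pow_zero, mul_one]
      linarith
  | succ l ih => exact supportLine_succ_le_distortion hα fun β hβ _ => ih β hβ

theorem supportLine_le_quantizationError (l : ℕ) {n : ℕ} (hn : 1 ≤ n) :
    supportLine l n / 2 ≤ quantizationError mixedCantor n := by
  refine le_csInf ⟨_, {0}, Finset.singleton_nonempty 0, by simpa using hn, rfl⟩ ?_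
  rintro _ ⟨α, hα, hc, rfl⟩
  rw [distortion_mixedCantor]
  have h1 := (supportLine_anti l hc).trans (supportLine_le_distortion l α hα)
  have h2 := distortion_nonneg cantorP₂ α hα
  linarith

/-! ### Explicit quantizers. -/

theorem hasQuantizer_cantorP₁_one : HasQuantizer cantorP₁ 1 (1 / 72) := by
  refine ⟨{1 / 6}, Finset.singleton_nonempty _, by simp, ?_⟩
  have h := integral_cantorP₁_sq 1 (-(1 / 6))
  norm_num at h
  simp only [distortion, Finset.inf'_singleton, Real.norm_eq_abs, sq_abs]
  norm_num [sub_eq_add_neg, h]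

theorem hasQuantizer_cantorP₁_two_pow (l : ℕ) :
    HasQuantizer cantorP₁ (2 ^ l) ((1 / 9) ^ l * (1 / 72)) := by
  have h := HasQuantizer.two_pow (r := 1 / 3) (by norm_num) (by norm_num)
    hasQuantizer_cantorP₁_one l
  norm_num at h ⊢
  exact h

/-- The halves receive `2 ^ (l + 1)` and `2 ^ l` points; the error lies on `supportLine (l + 1)`,
midway along the chord. -/
theorem hasQuantizer_cantorP₁_two_pow_add (l : ℕ) :
    HasQuantizer cantorP₁ (2 ^ (l + 1) + 2 ^ l) ((1 / 9) ^ (l + 1) * (5 / 648)) := by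
  have h := HasQuantizer.join (r := 1 / 3) (by norm_num) (by norm_num)
    (hasQuantizer_cantorP₁_two_pow (l + 1)) (hasQuantizer_cantorP₁_two_pow l)
  have e : (1 / 9 : ℝ) ^ (l + 1) * (5 / 648) =
      (1 / 3) ^ 2 * ((1 / 9) ^ (l + 1) * (1 / 72) + (1 / 9) ^ l * (1 / 72)) / 2 := by ring
  rw [e]
  exact h

/-- Only the rate `16⁻ˡ` matters, so any one-point set may supply the constant. -/
theorem exists_hasQuantizer_cantorP₂ :
    ∃ C, ∀ l, HasQuantizer cantorP₂ (2 ^ l) ((1 / 16) ^ l * C) := by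
  refine ⟨distortion cantorP₂ {0} (Finset.singleton_nonempty 0), fun l => ?_⟩
  have h := HasQuantizer.two_pow (r := 1 / 4) (b₀ := 1 / 2) (b₁ := 3 / 4) (by norm_num)
    (by norm_num) ⟨{0}, Finset.singleton_nonempty 0, by simp, le_rfl⟩ l
  norm_num at h ⊢
  exact h

/-! ### The two limits. -/

theorem two_rpow_two_div_log : (2 : ℝ) ^ (2 / (Real.log 2 / Real.log 3)) = 9 := by
  have h2 : Real.log 2 ≠ 0 := (Real.log_pos (by norm_num)).ne'
  have h3 : Real.log 3 ≠ 0 := (Real.log_pos (by norm_num)).ne'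
  rw [Real.rpow_def_of_pos (by norm_num)]
  have e : Real.log 2 * (2 / (Real.log 2 / Real.log 3)) = Real.log 3 * 2 := by field_simp
  rw [e, ← Real.rpow_def_of_pos (by norm_num)]
  norm_num

/-- The limit of `n^{2/β} V_n` along sequences `N` with `N / 2^l` convergent, given sharp enough
upper bounds. -/
theorem tendsto_rpow_mul_quantizationError {s ρ : ℝ} (hs : (2 : ℝ) ^ s = 9) (hρ : 0 < ρ)
    {N l : ℕ → ℕ} {u : ℕ → ℝ} (hN : ∀ n, 1 ≤ N n)
    (hlim : Tendsto (fun n => (N n : ℝ) / 2 ^ l n) atTop (𝓝 ρ))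
    (hu : ∀ n, quantizationError mixedCantor (N n) ≤ u n)
    (hulim : Tendsto (fun n => 9 ^ l n * u n) atTop (𝓝 ((17 - 8 * ρ) / 1296))) :
    Tendsto (fun n => (N n : ℝ) ^ s * quantizationError mixedCantor (N n)) atTop
      (𝓝 (ρ ^ s * ((17 - 8 * ρ) / 1296))) := by
  have hV : Tendsto (fun n => 9 ^ l n * quantizationError mixedCantor (N n)) atTop
      (𝓝 ((17 - 8 * ρ) / 1296)) := by
    refine tendsto_of_tendsto_of_tendsto_of_le_of_le
      (((hlim.const_mul 8).const_sub 17).div_const 1296) hulim (fun n => ?_) (fun n => ?_)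
    · have h := mul_le_mul_of_nonneg_left (supportLine_le_quantizationError (l n) (hN n))
        (by positivity : (0 : ℝ) ≤ 9 ^ l n)
      refine le_trans (le_of_eq ?_) h
      have e : (18 : ℝ) ^ l n = 9 ^ l n * 2 ^ l n := by rw [← mul_pow]; norm_num
      simp only [supportLine, one_div, inv_pow, e]
      field_simp
      ring
    · exact mul_le_mul_of_nonneg_left (hu n) (by positivity)
  -- Since `(2 ^ l) ^ s = 9 ^ l`, the quantity factors as `(N / 2 ^ l) ^ s` times `9 ^ l * V_N`.
  refine ((hlim.rpow_const (Or.inl hρ.ne')).mul hV).congr fun n => ?_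
  have e : ((2 : ℝ) ^ l n) ^ s = 9 ^ l n := by
    rw [← Real.rpow_natCast, ← Real.rpow_mul (by norm_num), mul_comm, Real.rpow_mul (by norm_num),
      hs, Real.rpow_natCast]
  rw [Real.div_rpow (by positivity) (by positivity), e]
  field_simp

theorem seqF_succ (n : ℕ) : seqF (n + 1) = 2 ^ (6 * n + 2) + 2 ^ (5 * n + 1) := rfl

theorem seqG_succ (n : ℕ) :
    seqG (n + 1) = 2 ^ (6 * n + 1 + 1) + 2 ^ (6 * n + 1) + 2 ^ (5 * n + 2) := rfl

theorem tendsto_seqF {s : ℝ} (hs : (2 : ℝ) ^ s = 9) :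
    Tendsto (fun n : ℕ => (seqF n : ℝ) ^ s * quantizationError mixedCantor (seqF n)) atTop
      (𝓝 (1 / 144)) := by
  obtain ⟨C, hC⟩ := exists_hasQuantizer_cantorP₂
  rw [← tendsto_add_atTop_iff_nat 1]
  have h := tendsto_rpow_mul_quantizationError hs one_pos (N := fun n => seqF (n + 1))
    (l := fun n => 6 * n + 2)
    (u := fun n => ((1 / 9) ^ (6 * n + 2) * (1 / 72) + (1 / 16) ^ (5 * n + 1) * C) / 2)
    (fun n => (Nat.one_le_two_pow).trans (Nat.le_add_right _ _)) ?_
    (fun n => quantizationError_mixedCantor_le (hasQuantizer_cantorP₁_two_pow _) (hC _)) ?_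
  · convert h using 2
    norm_num
  · have h1 := ((tendsto_pow_atTop_nhds_zero_of_lt_one (r := (1 / 2 : ℝ)) (by norm_num)
      (by norm_num)).div_const 2).const_add 1
    norm_num at h1
    refine h1.congr fun n => ?_
    have e : (2 : ℝ) ^ (6 * n + 2) = 2 ^ (5 * n + 1) * 2 ^ n * 2 := by ring
    rw [seqF_succ]
    push_cast
    rw [e, one_div_pow]
    field_simp
  -- The rescaled `cantorP₂` error decays like `(9^6 / 16^5)^n`; the factor `81/32` collects the
  -- offsets `9^2`, `16` and the weight `1/2`.
  · have h1 := ((tendsto_pow_atTop_nhds_zero_of_lt_one (r := (9 ^ 6 / 16 ^ 5 : ℝ)) (by norm_num)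
      (by norm_num)).mul_const (81 / 32 * C)).const_add (1 / 144)
    have e0 : (1 / 144 + 0 * (81 / 32 * C) : ℝ) = (17 - 8 * 1) / 1296 := by norm_num
    rw [e0] at h1
    refine h1.congr fun n => ?_
    simp only [pow_add, pow_mul, one_div, inv_pow, div_pow]
    field_simp
    ring

theorem tendsto_seqG {s : ℝ} (hs : (2 : ℝ) ^ s = 9) :
    Tendsto (fun n : ℕ => (seqG n : ℝ) ^ s * quantizationError mixedCantor (seqG n)) atTop
      (𝓝 ((3 / 2) ^ s * (5 / 1296))) := by
  obtain ⟨C, hC⟩ := exists_hasQuantizer_cantorP₂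
  rw [← tendsto_add_atTop_iff_nat 1]
  have h := tendsto_rpow_mul_quantizationError hs (ρ := 3 / 2) (by norm_num)
    (N := fun n => seqG (n + 1)) (l := fun n => 6 * n + 1 + 1)
    (u := fun n => ((1 / 9) ^ (6 * n + 1 + 1) * (5 / 648) + (1 / 16) ^ (5 * n + 2) * C) / 2)
    (fun n => (Nat.one_le_two_pow).trans ((Nat.le_add_right _ _).trans (Nat.le_add_right _ _))) ?_
    (fun n => quantizationError_mixedCantor_le (hasQuantizer_cantorP₁_two_pow_add _) (hC _)) ?_
  · convert h using 3
    norm_num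
  · have h1 := (tendsto_pow_atTop_nhds_zero_of_lt_one (r := (1 / 2 : ℝ)) (by norm_num)
      (by norm_num)).const_add (3 / 2)
    rw [add_zero] at h1
    refine h1.congr fun n => ?_
    have e : (2 : ℝ) ^ (6 * n + 1 + 1) = 2 ^ (5 * n + 2) * 2 ^ n := by ring
    have e' : (2 : ℝ) ^ (6 * n + 1) = 2 ^ (5 * n + 2) * 2 ^ n / 2 := by ring
    rw [seqG_succ]
    push_cast
    rw [e, e', one_div_pow]
    field_simp
    ring
  · have h1 := ((tendsto_pow_atTop_nhds_zero_of_lt_one (r := (9 ^ 6 / 16 ^ 5 : ℝ)) (by norm_num)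
      (by norm_num)).mul_const (81 / 512 * C)).const_add (5 / 1296)
    have e0 : (5 / 1296 + 0 * (81 / 512 * C) : ℝ) = (17 - 8 * (3 / 2)) / 1296 := by norm_num
    rw [e0] at h1
    refine h1.congr fun n => ?_
    simp only [pow_add, pow_mul, one_div, inv_pow, div_pow]
    field_simp
    ring

theorem three_halves_rpow_mul :
    (3 / 2 : ℝ) ^ (2 / (Real.log 2 / Real.log 3)) * (5 / 1296) =
      5 / 16 * (3 : ℝ) ^ (2 * Real.log 3 / Real.log 2 - 6) := by
  have h6 : (3 : ℝ) ^ (6 : ℝ) = 729 := by norm_num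
  rw [Real.div_rpow (by norm_num) (by norm_num), two_rpow_two_div_log,
    Real.rpow_sub (by norm_num), h6, div_div_eq_mul_div]
  ring

theorem limits_ne : (1 / 144 : ℝ) ≠ 5 / 16 * (3 : ℝ) ^ (2 * Real.log 3 / Real.log 2 - 6) := by
  have h2 : 0 < Real.log 2 := Real.log_pos (by norm_num)
  have h : 3 ≤ 2 * Real.log 3 / Real.log 2 := by
    rw [le_div_iff₀ h2]
    -- From `2^3 ≤ 3^2` the second limit is at least `5/16 * 3^(-3) = 5/432`, above `1/144 = 3/432`.
    have := Real.log_le_log (by norm_num) (by norm_num : (2 : ℝ) ^ 3 ≤ 3 ^ 2)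
    rw [Real.log_pow, Real.log_pow] at this
    exact_mod_cast this
  have h3 : (3 : ℝ) ^ (-3 : ℝ) ≤ 3 ^ (2 * Real.log 3 / Real.log 2 - 6) :=
    Real.rpow_le_rpow_of_exponent_le (by norm_num) (by linarith)
  have h4 : (3 : ℝ) ^ (-3 : ℝ) = 1 / 27 := by
    rw [Real.rpow_neg (by norm_num)]
    norm_num
  rw [h4] at h3
  exact (by linarith : (1 / 144 : ℝ) < _).ne

/-! ### Monotonicity and nonexistence of the coefficient. -/

theorem strictMonoOn_seqF : StrictMonoOn seqF (Set.Ici 1) := by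
  intro a ha b _ hab
  have ha' : 1 ≤ a := ha
  exact add_lt_add (Nat.pow_lt_pow_right (by norm_num) (by omega))
    (Nat.pow_lt_pow_right (by norm_num) (by omega))

theorem strictMonoOn_seqG : StrictMonoOn seqG (Set.Ici 1) := by
  intro a ha b _ hab
  have ha' : 1 ≤ a := ha
  exact add_lt_add (add_lt_add (Nat.pow_lt_pow_right (by norm_num) (by omega))
    (Nat.pow_lt_pow_right (by norm_num) (by omega)))
    (Nat.pow_lt_pow_right (by norm_num) (by omega))

theorem StrictMonoOn.tendsto_atTop_of_Ici {f : ℕ → ℕ} (h : StrictMonoOn f (Set.Ici 1)) :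
    Tendsto f atTop atTop := by
  rw [← tendsto_add_atTop_iff_nat 1]
  exact StrictMono.tendsto_atTop fun a b hab =>
    h (Nat.le_add_left _ _) (Nat.le_add_left _ _) (Nat.add_lt_add_right hab 1)

/-- In the extended reals, equality of lower and upper limits gives convergence with no boundedness
condition, so all subsequences would share one limit. -/
theorem not_quantizationCoefficientExists {s : ℝ} {P : Measure ℝ} {f g : ℕ → ℕ} {x y : ℝ}
    (hf : Tendsto f atTop atTop) (hg : Tendsto g atTop atTop) (hxy : x ≠ y)
    (hx : Tendsto (fun n => (f n : ℝ) ^ (2 / s) * quantizationError P (f n)) atTop (𝓝 x))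
    (hy : Tendsto (fun n => (g n : ℝ) ^ (2 / s) * quantizationError P (g n)) atTop (𝓝 y)) :
    ¬ QuantizationCoefficientExists s P := by
  intro h
  have ht := tendsto_of_liminf_eq_limsup h rfl
  have h1 := tendsto_nhds_unique (ht.comp hf)
    (continuous_coe_real_ereal.continuousAt.tendsto.comp hx)
  have h2 := tendsto_nhds_unique (ht.comp hg)
    (continuous_coe_real_ereal.continuousAt.tendsto.comp hy)
  exact hxy (EReal.coe_injective (h1.symm.trans h2))

theorem mainTheorem4 :
    let β : ℝ := Real.log 2 / Real.log 3
    let V : ℕ → ℝ := quantizationError mixedCantor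
    ¬ QuantizationCoefficientExists β mixedCantor ∧
    StrictMonoOn seqF (Set.Ici 1) ∧
    StrictMonoOn seqG (Set.Ici 1) ∧
    Tendsto (fun n : ℕ => (seqF n : ℝ) ^ (2 / β) * V (seqF n)) atTop (𝓝 (1 / 144)) ∧
    Tendsto (fun n : ℕ => (seqG n : ℝ) ^ (2 / β) * V (seqG n)) atTop
      (𝓝 (5 / 16 * (3 : ℝ) ^ (2 * Real.log 3 / Real.log 2 - 6))) ∧
    (1 / 144 : ℝ) ≠ 5 / 16 * (3 : ℝ) ^ (2 * Real.log 3 / Real.log 2 - 6) := by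
  intro β V
  have hF := tendsto_seqF two_rpow_two_div_log
  have hG := tendsto_seqG two_rpow_two_div_log
  rw [three_halves_rpow_mul] at hG
  exact ⟨not_quantizationCoefficientExists strictMonoOn_seqF.tendsto_atTop_of_Ici
    strictMonoOn_seqG.tendsto_atTop_of_Ici limits_ne hF hG,
    strictMonoOn_seqF, strictMonoOn_seqG, hF, hG, limits_ne⟩
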